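/- Let $d\ge 2$, $\alpha\in(0,d-1)$, $\beta>0$, $\gamma>0$. Let $\omega_n$ be the volume of the unit ball of $\mathbb R^n$, and let $B_1\subset\mathbb R^d$ be the unit ball centred at the origin. For $\sigma>-(d-1)$ and $k\ge 0$ set \[ \mu_k(\sigma)=(d-1)\,\omega_{d-1}\,2^{d-1+\sigma}\,\frac{\Gamma\left(\frac{d-1+\sigma}{2}\right)\Gamma\left(\frac{d-1}{2}\right)}{\Gamma\left(\frac{2d-2+\sigma}{2}\right)}\left[1-\prod_{j=0}^{k-1}\frac{j-\frac{\sigma}{2}}{j+d-1+\frac{\sigma}{2}}\right] \] (so that $\mu_0(\sigma)=0$), and define the thresholds \[ \gamma_*=\sup_{k\ge 2}\frac{\mu_k(-\alpha)-\mu_1(-\alpha)}{\mu_1(\beta)-\mu_k(\beta)},\qquad \gamma_{**}=\inf_{k\ge 2}\frac{\mu_k(-\alpha)-\mu_1(-\alpha)}{\mu_1(\beta)-\mu_k(\beta)} . \] Then the potential of the unit ball \[ \psi(x)=\int_{B_1}\frac{dy}{|x-y|^{\alpha}}+\gamma\int_{B_1}|x-y|^{\beta}\,dy,\qquad x\in\mathbb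 R^d, \] is well defined (both integrals converge for every $x$), is of class $C^1$ on $\mathbb R^d$, and is radial: $\psi(x)=p(|x|)$ for a function $p$ of class $C^1$ on $[0,\infty)$. Moreover $p'(1)>0$ if $\gamma>\gamma_*$, and $p'(1)<0$ if $\gamma<\gamma_{**}$. -/

import Mathlib

open MeasureTheory

/-- The volume `ω_n` of the unit ball of `ℝⁿ`. -/
noncomputable def unitBallVolume (n : ℕ) : ℝ :=
  (volume (Metric.ball (0 : EuclideanSpace ℝ (Fin n)) 1)).toReal

/-- The sequence `μ_k(σ)`, for `σ > -(d-1)`. For `k = 0` the product is empty, so `μ_0(σ) = 0`. -/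
noncomputable def muCoeff (d : ℕ) (σ : ℝ) (k : ℕ) : ℝ :=
  ((d : ℝ) - 1) * unitBallVolume (d - 1) * (2 : ℝ) ^ ((d : ℝ) - 1 + σ) *
    (Real.Gamma (((d : ℝ) - 1 + σ) / 2) * Real.Gamma (((d : ℝ) - 1) / 2) /
      Real.Gamma ((2 * (d : ℝ) - 2 + σ) / 2)) *
    (1 - ∏ j ∈ Finset.range k, ((j : ℝ) - σ / 2) / ((j : ℝ) + (d : ℝ) - 1 + σ / 2))

/-- The quotient `(μ_k(-α) - μ_1(-α)) / (μ_1(β) - μ_k(β))`. -/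
noncomputable def stabilityQuotient (d : ℕ) (α β : ℝ) (k : ℕ) : ℝ :=
  (muCoeff d (-α) k - muCoeff d (-α) 1) / (muCoeff d β 1 - muCoeff d β k)

/-- The upper stability threshold `γ_*`, a supremum over `k ≥ 2` taken in the extended reals. -/
noncomputable def gammaStar (d : ℕ) (α β : ℝ) : EReal :=
  ⨆ (k : ℕ) (_ : 2 ≤ k), (stabilityQuotient d α β k : EReal)

/-- The lower stability threshold `γ_**`, an infimum over `k ≥ 2` taken in the extended reals. -/
noncomputable def gammaStarStar (d : ℕ) (α β : ℝ) : EReal :=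
  ⨅ (k : ℕ) (_ : 2 ≤ k), (stabilityQuotient d α β k : EReal)

/-- The potential `ψ` of the unit ball. -/
noncomputable def ballPotential (d : ℕ) (α β γ : ℝ) (x : EuclideanSpace ℝ (Fin d)) : ℝ :=
  (∫ y in Metric.ball (0 : EuclideanSpace ℝ (Fin d)) 1, 1 / ‖x - y‖ ^ α) +
    γ * ∫ y in Metric.ball (0 : EuclideanSpace ℝ (Fin d)) 1, ‖x - y‖ ^ β

/-!
Write `P σ x = ∫ y in B₁, ‖x - y‖ ^ σ`, so that the potential is `P (-α) + γ • P β`.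

*Regularity.* For `σ > 1 - d` both `‖z‖ ^ σ` and its gradient `σ ‖z‖ ^ (σ - 2) z` are locally
integrable. The average of a locally integrable function over a moving ball is continuous, since
spheres are null sets (`LocallyIntegrable.continuous_setIntegral_ball_sub_left`). In dimension at
least two almost every `y` lies off the line through `x` and `x + h`, so the fundamental theorem of
calculus on segments and Fubini give `P σ (x + h) - P σ x = ∫₀¹ G (x + t h) h dt`, where `G` is the
average of the gradient; as `G` is continuous it is the derivative of `P σ`
(`hasFDerivAt_setIntegral_ball_sub_left`). Radial symmetry comes from reflections, and the profile
is `p t = ψ (t e)` for a unit vector `e`.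

*The slope at the unit sphere.* After the translation `z = e - y` the derivative of `P σ (t e)` at
`t = 1` is `σ ∫_{|z - e| < 1} ‖z‖ ^ (σ - 2) ⟪z, e⟫ dz`. The ball `|z - e| < 1` is `r < 2 ⟪θ, e⟫` in
polar coordinates, so this is an explicit multiple of the hemisphere moment
`∫ (⟪θ, e⟫₊) ^ (d + σ) dθ` (`integral_ball_norm_rpow_mul_inner`). That moment is found by computing
a Gaussian moment both in polar and in Cartesian coordinates (`hemisphereMoment_single`). The result
is `ballSlope d σ`.

*The thresholds.* The product in `muCoeff d σ k` tends to `0` as `k → ∞`, because `d - 1 + σ > 0`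
(`tendsto_prod_div_atTop_zero`), and the resulting limit of `μ₁(σ) - μₖ(σ)` is `2 * ballSlope d σ`
(`tendsto_muCoeff_one_sub`). Hence the quotients defining the thresholds converge to
`-ballSlope d (-α) / ballSlope d β`, a number between the infimum and the supremum, while
`p' 1 = ballSlope d (-α) + γ * ballSlope d β` with `ballSlope d β > 0`. Comparing `γ` with the
limit gives both signs.
-/

/-! ### Integrals over moving balls of kernels with an integrable singularity -/

section Smoothing

open Filter Topology Metric

theorem indicator_ball_sub_left {E F : Type*} [NormedAddCommGroup E] [NormedAddCommGroup F]
    (f : E → F) (x y : E) (r : ℝ) :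
    (ball x r).indicator f (x - y) = (ball 0 r).indicator (fun y => f (x - y)) y := by
  have h : x - y ∈ ball x r ↔ y ∈ ball (0 : E) r := by simp [dist_eq_norm]
  by_cases hy : y ∈ ball (0 : E) r
  · rw [Set.indicator_of_mem hy, Set.indicator_of_mem (h.2 hy)]
  · rw [Set.indicator_of_notMem hy, Set.indicator_of_notMem (mt h.1 hy)]

variable {E F : Type*} [NormedAddCommGroup E] [NormedSpace ℝ E] [FiniteDimensional ℝ E]
  [MeasurableSpace E] [BorelSpace E] [NormedAddCommGroup F]
  (μ : Measure E) [μ.IsAddHaarMeasure]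

theorem MeasureTheory.LocallyIntegrable.integrableOn_ball_sub_left {μ : Measure E}
    [μ.IsAddHaarMeasure] {f : E → F} (hf : LocallyIntegrable f μ) (x : E) (r : ℝ) :
    IntegrableOn (fun y => f (x - y)) (ball 0 r) μ := by
  have h1 : Integrable ((ball x r).indicator f) μ :=
    (integrable_indicator_iff measurableSet_ball).2
      ((hf.integrableOn_isCompact (isCompact_closedBall x r)).mono_set ball_subset_closedBall)
  rw [← integrable_indicator_iff measurableSet_ball]
  simpa only [indicator_ball_sub_left] using h1.comp_sub_left x

variable [NormedSpace ℝ F]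

theorem setIntegral_ball_sub_left (f : E → F) (x : E) (r : ℝ) :
    ∫ y in ball 0 r, f (x - y) ∂μ = ∫ z in ball x r, f z ∂μ := by
  rw [← integral_indicator measurableSet_ball, ← integral_indicator measurableSet_ball,
    ← integral_sub_left_eq_self ((ball x r).indicator f) μ x]
  simp only [indicator_ball_sub_left]

/-- Averaging a locally integrable function over a moving ball gives a continuous function, because
spheres are null sets. -/
theorem MeasureTheory.LocallyIntegrable.continuous_setIntegral_ball_sub_left [Nontrivial E]
    {μ : Measure E} [μ.IsAddHaarMeasure] {f : E → F} (hf : LocallyIntegrable f μ) (r : ℝ) :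
    Continuous fun x => ∫ y in ball 0 r, f (x - y) ∂μ := by
  rw [continuous_iff_continuousAt]
  intro x₀
  simp only [setIntegral_ball_sub_left μ f, ← integral_indicator measurableSet_ball (f := f)]
  have hint := hf.integrableOn_isCompact (isCompact_closedBall x₀ (r + 1))
  refine continuousAt_of_dominated (bound := (closedBall x₀ (r + 1)).indicator fun z => ‖f z‖)
    (.of_forall fun x => (hf.aestronglyMeasurable).indicator measurableSet_ball) ?_
    ((integrable_indicator_iff measurableSet_closedBall).2 hint.norm) ?_
  · filter_upwards [ball_mem_nhds x₀ one_pos] with x hx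
    refine .of_forall fun z => ?_
    by_cases hz : z ∈ ball x r
    · have : z ∈ closedBall x₀ (r + 1) := by
        rw [mem_ball] at hz hx
        rw [mem_closedBall]
        linarith [dist_triangle z x x₀]
      simp only [Set.indicator_of_mem hz, Set.indicator_of_mem this, le_refl]
    · simp only [Set.indicator_of_notMem hz, norm_zero]
      exact Set.indicator_nonneg (fun _ _ => norm_nonneg _) _
  · have hs : ∀ᵐ z ∂μ, z ∉ sphere x₀ r :=
      measure_eq_zero_iff_ae_notMem.1 (Measure.addHaar_sphere μ x₀ r)
    filter_upwards [hs] with z hz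
    -- Off the sphere, membership of `z` in `ball x r` does not change for `x` near `x₀`.
    rcases lt_or_gt_of_ne (show dist z x₀ ≠ r from hz) with h | h
    · have : ∀ᶠ x in 𝓝 x₀, dist z x < r :=
        (continuous_const.dist continuous_id).continuousAt.eventually_lt_const h
      exact (continuousAt_const (y := f z)).congr
        (this.mono fun x hx => (Set.indicator_of_mem (mem_ball.2 hx) f).symm)
    · have : ∀ᶠ x in 𝓝 x₀, r < dist z x :=
        (continuous_const.dist continuous_id).continuousAt.eventually_const_lt h
      exact (continuousAt_const (y := (0 : F))).congr
        (this.mono fun x hx => (Set.indicator_of_notMem (s := ball x r) (by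
          rw [mem_ball]; exact not_lt.2 hx.le) f).symm)

/-- A line is a null set in dimension at least two. -/
theorem ae_notMem_line (hE : 2 ≤ Module.finrank ℝ E) (x h : E) :
    ∀ᵐ y ∂μ, ∀ t : ℝ, x + t • h - y ≠ 0 := by
  have hne : AffineSubspace.mk' x (Submodule.span ℝ {h}) ≠ ⊤ := by
    intro htop
    have := congrArg AffineSubspace.direction htop
    rw [AffineSubspace.direction_mk', AffineSubspace.direction_top] at this
    have h1 := finrank_span_le_card (R := ℝ) ({h} : Set E)
    rw [this, finrank_top] at h1
    simp at h1
    omega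
  filter_upwards [measure_eq_zero_iff_ae_notMem.1 (Measure.addHaar_affineSubspace μ _ hne)]
    with y hy t ht
  apply hy
  rw [← sub_eq_zero.1 ht, SetLike.mem_coe, AffineSubspace.mem_mk', vsub_eq_sub, add_sub_cancel_left]
  exact Submodule.smul_mem _ _ (Submodule.mem_span_singleton_self h)

variable {μ} {k : E → ℝ} {k' : E → E →L[ℝ] ℝ}

/-- The fundamental theorem of calculus along `[x, x + h]`, averaged over a ball: segments through the
singularity of the kernel come from a null set of points `y`, and Fubini exchanges the two
integrals. -/
theorem setIntegral_ball_sub_left_sub (hE : 2 ≤ Module.finrank ℝ E)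
    (hk : LocallyIntegrable k μ) (hk' : LocallyIntegrable k' μ)
    (hcont : ContinuousOn k' {0}ᶜ) (hderiv : ∀ z ≠ 0, HasFDerivAt k (k' z) z) (r : ℝ) (x h : E) :
    (∫ y in ball 0 r, k (x + h - y) ∂μ) - ∫ y in ball 0 r, k (x - y) ∂μ =
      ∫ t in (0 : ℝ)..1, (∫ y in ball 0 r, k' (x + t • h - y) ∂μ) h := by
  have : Nontrivial E := Module.nontrivial_of_finrank_pos (R := ℝ) (by omega)
  have hkh : LocallyIntegrable (fun z => k' z h) μ :=
    fun z => (hk' z).imp fun s hs => ⟨hs.1, hs.2.apply_continuousLinearMap h⟩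
  have hmeas : Measurable fun z => k' z h :=
    measurable_of_continuousOn_compl_singleton 0 (hcont.clm_apply continuousOn_const)
  -- The fundamental theorem of calculus holds along the segments that miss the singularity.
  have hFTC : ∀ᵐ y ∂μ.restrict (ball 0 r),
      k (x + h - y) - k (x - y) = ∫ t in (0 : ℝ)..1, k' (x + t • h - y) h := by
    filter_upwards [ae_restrict_of_ae (ae_notMem_line μ hE x h)] with y hy
    have hd : ∀ t : ℝ, HasDerivAt (fun s : ℝ => x + s • h - y) h t := fun t => by
      simpa using (((hasDerivAt_id t).smul_const h).const_add x).sub_const y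
    rw [intervalIntegral.integral_eq_sub_of_hasDerivAt (f := fun t : ℝ => k (x + t • h - y))
      (fun t _ => (hderiv _ (hy t)).comp_hasDerivAt t (hd t))]
    · simp
    · refine ContinuousOn.intervalIntegrable ?_
      refine ContinuousOn.clm_apply (hcont.comp (by fun_prop) fun t _ => hy t) continuousOn_const
  have hprod : Integrable (fun p : ℝ × E => k' (x + p.1 • h - p.2) h)
      ((volume.restrict (Set.uIoc 0 1)).prod (μ.restrict (ball 0 r))) := by
    rw [integrable_prod_iff]
    · refine ⟨.of_forall fun t => hkh.integrableOn_ball_sub_left (x + t • h) r, ?_⟩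
      have hc : Continuous fun t : ℝ => ∫ y in ball 0 r, ‖k' (x + t • h - y) h‖ ∂μ :=
        (LocallyIntegrable.continuous_setIntegral_ball_sub_left (f := fun z => ‖k' z h‖)
          (fun z => (hkh z).imp fun s hs => ⟨hs.1, hs.2.norm⟩) r).comp
          (by fun_prop : Continuous fun t : ℝ => x + t • h)
      exact (hc.integrableOn_Icc (a := 0) (b := 1)).mono_set (by
        rw [Set.uIoc_of_le zero_le_one]; exact Set.Ioc_subset_Icc_self)
    · exact (hmeas.comp (by fun_prop)).aestronglyMeasurable
  rw [← integral_sub (hk.integrableOn_ball_sub_left (x + h) r) (hk.integrableOn_ball_sub_left x r),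
    integral_congr_ae hFTC, ← intervalIntegral_integral_swap hprod]
  refine intervalIntegral.integral_congr fun t _ => ?_
  exact (ContinuousLinearMap.integral_apply (hk'.integrableOn_ball_sub_left (x + t • h) r) h).symm

/-- Differentiation under the integral sign for a kernel with an integrable singularity. -/
theorem hasFDerivAt_setIntegral_ball_sub_left (hE : 2 ≤ Module.finrank ℝ E)
    (hk : LocallyIntegrable k μ) (hk' : LocallyIntegrable k' μ)
    (hcont : ContinuousOn k' {0}ᶜ) (hderiv : ∀ z ≠ 0, HasFDerivAt k (k' z) z) (r : ℝ) (x : E) :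
    HasFDerivAt (fun x => ∫ y in ball 0 r, k (x - y) ∂μ) (∫ y in ball 0 r, k' (x - y) ∂μ) x := by
  have : Nontrivial E := Module.nontrivial_of_finrank_pos (R := ℝ) (by omega)
  set G : E → E →L[ℝ] ℝ := fun x => ∫ y in ball 0 r, k' (x - y) ∂μ with hG
  have hGc : Continuous G := hk'.continuous_setIntegral_ball_sub_left r
  rw [hasFDerivAt_iff_isLittleO_nhds_zero, Asymptotics.isLittleO_iff]
  intro c hc
  obtain ⟨δ, hδ, hδ'⟩ := Metric.continuous_iff.1 hGc x c hc
  filter_upwards [ball_mem_nhds 0 hδ] with h hh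
  have hint : IntervalIntegrable (fun t : ℝ => G (x + t • h) h) volume 0 1 :=
    Continuous.intervalIntegrable (by fun_prop) _ _
  have e : (∫ y in ball 0 r, k (x + h - y) ∂μ) - (∫ y in ball 0 r, k (x - y) ∂μ) - G x h =
      ∫ t in (0 : ℝ)..1, (G (x + t • h) - G x) h := by
    rw [setIntegral_ball_sub_left_sub hE hk hk' hcont hderiv]
    simp only [_root_.sub_apply]
    rw [intervalIntegral.integral_sub hint (by simp)]
    simp [hG]
  rw [e]
  refine (intervalIntegral.norm_integral_le_of_norm_le_const (C := c * ‖h‖) fun t ht => ?_).trans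
    (by simp)
  refine (ContinuousLinearMap.le_opNorm _ _).trans ?_
  gcongr
  rw [← dist_eq_norm]
  refine (hδ' _ ?_).le
  rw [Set.uIoc_of_le zero_le_one] at ht
  rw [dist_eq_norm, add_sub_cancel_left, norm_smul, Real.norm_of_nonneg ht.1.le]
  rw [mem_ball_zero_iff] at hh
  exact (mul_le_of_le_one_left (norm_nonneg _) ht.2).trans_lt hh

theorem contDiff_one_setIntegral_ball_sub_left (hE : 2 ≤ Module.finrank ℝ E)
    (hk : LocallyIntegrable k μ) (hk' : LocallyIntegrable k' μ)
    (hcont : ContinuousOn k' {0}ᶜ) (hderiv : ∀ z ≠ 0, HasFDerivAt k (k' z) z) (r : ℝ) :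
    ContDiff ℝ 1 fun x => ∫ y in ball 0 r, k (x - y) ∂μ := by
  have : Nontrivial E := Module.nontrivial_of_finrank_pos (R := ℝ) (by omega)
  have hd := hasFDerivAt_setIntegral_ball_sub_left hE hk hk' hcont hderiv r
  rw [contDiff_one_iff_fderiv]
  refine ⟨fun x => (hd x).differentiableAt, ?_⟩
  rw [funext fun x => (hd x).fderiv]
  exact hk'.continuous_setIntegral_ball_sub_left r

end Smoothing

/-! ### The kernel `‖z‖ ^ σ` and its derivative -/

section PowerKernel

open Metric

variable {E : Type*} [NormedAddCommGroup E] [InnerProductSpace ℝ E]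

/-- The derivative of `z ↦ ‖z‖ ^ σ` away from the origin; at the origin it takes the value `0`. -/
noncomputable def normRpowDeriv (σ : ℝ) (z : E) : E →L[ℝ] ℝ :=
  (σ * ‖z‖ ^ (σ - 2)) • innerSL ℝ z

theorem hasFDerivAt_norm_rpow_of_ne (σ : ℝ) {z : E} (hz : z ≠ 0) :
    HasFDerivAt (fun z : E => ‖z‖ ^ σ) (normRpowDeriv σ z) z := by
  have h := (hasStrictFDerivAt_norm_sq z).hasFDerivAt.rpow_const (p := σ / 2) (Or.inl (by simpa))
  have e : (fun z : E => (‖z‖ ^ 2) ^ (σ / 2)) = fun z : E => ‖z‖ ^ σ := by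
    ext z
    rw [← Real.rpow_natCast_mul (norm_nonneg _)]
    congr 1; push_cast; ring
  rw [e] at h
  convert h using 1
  ext w
  have : (‖z‖ ^ 2) ^ (σ / 2 - 1) = ‖z‖ ^ (σ - 2) := by
    rw [← Real.rpow_natCast_mul (norm_nonneg _)]
    congr 1; push_cast; ring
  simp [normRpowDeriv, this]
  ring

theorem continuousOn_normRpowDeriv (σ : ℝ) :
    ContinuousOn (normRpowDeriv σ : E → E →L[ℝ] ℝ) {0}ᶜ := by
  refine ContinuousOn.smul (continuousOn_const.mul (continuous_norm.continuousOn.rpow_const ?_))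
    (innerSL ℝ).continuous.continuousOn
  intro z hz
  exact Or.inl (norm_ne_zero_iff.2 hz)

theorem norm_normRpowDeriv_le (σ : ℝ) (z : E) : ‖normRpowDeriv σ z‖ ≤ |σ| * ‖z‖ ^ (σ - 1) := by
  rcases eq_or_ne z 0 with rfl | hz
  · simp only [normRpowDeriv, map_zero, smul_zero, norm_zero]
    positivity
  · rw [normRpowDeriv, norm_smul, norm_mul, innerSL_apply_norm, Real.norm_eq_abs,
      Real.norm_of_nonneg (by positivity), mul_assoc, ← Real.rpow_add_one (norm_ne_zero_iff.2 hz)]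
    ring_nf; rfl

variable [FiniteDimensional ℝ E] [MeasurableSpace E] [BorelSpace E] (μ : Measure E)
  [μ.IsAddHaarMeasure] {σ : ℝ}

theorem locallyIntegrable_norm_rpow (hE : 1 ≤ Module.finrank ℝ E)
    (hσ : -(Module.finrank ℝ E : ℝ) < σ) : LocallyIntegrable (fun z : E => ‖z‖ ^ σ) μ := by
  refine locallyIntegrable_of_norm_le_rpow (C := 1) (α := -σ) hE (by linarith) ?_ ?_
  · refine .of_forall fun z => ?_
    rw [neg_neg, one_mul, Real.norm_of_nonneg (by positivity)]
  · exact (measurable_norm.pow_const σ).aestronglyMeasurable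

theorem locallyIntegrable_normRpowDeriv (hE : 1 ≤ Module.finrank ℝ E)
    (hσ : 1 - (Module.finrank ℝ E : ℝ) < σ) :
    LocallyIntegrable (normRpowDeriv σ : E → E →L[ℝ] ℝ) μ := by
  refine locallyIntegrable_of_norm_le_rpow (C := |σ|) (α := 1 - σ) hE (by linarith) ?_ ?_
  · refine .of_forall fun z => ?_
    rw [neg_sub]
    exact norm_normRpowDeriv_le σ z
  · have : Measurable (normRpowDeriv σ : E → E →L[ℝ] ℝ) :=
      measurable_of_continuousOn_compl_singleton 0 (continuousOn_normRpowDeriv σ)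
    exact this.aestronglyMeasurable

end PowerKernel

/-! ### Polar coordinates and moments of the hemisphere -/

section Polar

open Metric Set

variable {E : Type*} [NormedAddCommGroup E] [InnerProductSpace ℝ E] [FiniteDimensional ℝ E]
  [MeasurableSpace E] [BorelSpace E] (μ : Measure E) [μ.IsAddHaarMeasure]

theorem integral_polar (f : E → ℝ) [Nontrivial E] :
    ∫ z, f z ∂μ = ∫ p : sphere (0 : E) 1 × Ioi (0 : ℝ), f ((p.2 : ℝ) • (p.1 : E))
      ∂μ.toSphere.prod (.volumeIoiPow (Module.finrank ℝ E - 1)) := by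
  have h := μ.measurePreserving_homeomorphUnitSphereProd.symm
    (homeomorphUnitSphereProd E).toMeasurableEquiv |>.integral_comp
    (homeomorphUnitSphereProd E).symm.measurableEmbedding (fun z => f z.1)
  rw [integral_subtype_comap (measurableSet_singleton _).compl f, restrict_compl_singleton] at h
  rw [← h]
  rfl

theorem integrable_polar [Nontrivial E] {f : E → ℝ} (hf : Integrable f μ) :
    Integrable (fun p : sphere (0 : E) 1 × Ioi (0 : ℝ) => f ((p.2 : ℝ) • (p.1 : E)))
      (μ.toSphere.prod (.volumeIoiPow (Module.finrank ℝ E - 1))) := by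
  have h := μ.measurePreserving_homeomorphUnitSphereProd.symm
    (homeomorphUnitSphereProd E).toMeasurableEquiv |>.integrable_comp_emb
    (homeomorphUnitSphereProd E).symm.measurableEmbedding (g := fun z => f z.1)
  refine h.2 ?_
  rw [← restrict_compl_singleton (μ := μ) 0, ← IntegrableOn,
    integrableOn_iff_comap_subtypeVal (measurableSet_singleton _).compl] at hf
  exact hf

theorem integral_volumeIoiPow (n : ℕ) (g : ℝ → ℝ) :
    ∫ r : Ioi (0 : ℝ), g r ∂.volumeIoiPow n = ∫ r in Ioi (0 : ℝ), r ^ n * g r := by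
  simp only [Measure.volumeIoiPow, ENNReal.ofReal]
  rw [integral_withDensity_eq_integral_smul (measurable_subtype_coe.pow_const _).real_toNNReal,
    integral_subtype_comap measurableSet_Ioi fun a ↦ Real.toNNReal (a ^ n) • g a,
    setIntegral_congr_fun measurableSet_Ioi fun x hx ↦ ?_]
  rw [NNReal.smul_def, Real.coe_toNNReal _ (pow_nonneg hx.out.le _), smul_eq_mul]

/-- The integral of the `m`-th power of the positive part of `⟪θ, e⟫` over the unit sphere. -/
noncomputable def hemisphereMoment (e : E) (m : ℝ) : ℝ :=
  ∫ θ : sphere (0 : E) 1, (max (inner ℝ (θ : E) e) 0) ^ m ∂μ.toSphere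

/-- The Gaussian moment of `⟪z, e⟫₊` in polar coordinates, where its integrand is a product of a
function of `θ` and a function of `r`. -/
theorem integral_gaussian_eq_hemisphereMoment [Nontrivial E] (e : E) {m : ℝ} (hm : 0 < m) :
    ∫ z, (max (inner ℝ z e) 0) ^ m * Real.exp (-‖z‖ ^ (2 : ℝ)) ∂μ =
      hemisphereMoment μ e m * (1 / 2 * Real.Gamma ((m + Module.finrank ℝ E) / 2)) := by
  have hn : 1 ≤ Module.finrank ℝ E := Module.finrank_pos
  rw [integral_polar, hemisphereMoment]
  have e1 : ∀ p : sphere (0 : E) 1 × Ioi (0 : ℝ),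
      (max (inner ℝ ((p.2 : ℝ) • (p.1 : E)) e) 0) ^ m *
        Real.exp (-‖(p.2 : ℝ) • (p.1 : E)‖ ^ (2 : ℝ)) =
      (max (inner ℝ (p.1 : E) e) 0) ^ m *
        ((fun r : ℝ => r ^ m * Real.exp (-r ^ (2 : ℝ))) (p.2 : ℝ)) := by
    rintro ⟨⟨θ, hθ⟩, ⟨r, hr⟩⟩
    have hr' : 0 < r := hr
    have hθ' : ‖θ‖ = 1 := by simpa using hθ
    simp only [norm_smul, hθ', inner_smul_left, mul_one, Real.norm_of_nonneg hr'.le]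
    have : max ((starRingEnd ℝ) r * inner ℝ θ e) 0 = r * max (inner ℝ θ e) 0 := by
      rw [mul_max_of_nonneg _ _ hr'.le, mul_zero]; rfl
    rw [this, Real.mul_rpow hr'.le (le_max_right _ _)]
    ring
  simp only [e1]
  rw [integral_prod_mul (fun θ : sphere (0 : E) 1 => (max (inner ℝ (θ : E) e) 0) ^ m)
    (fun r : Ioi (0 : ℝ) => (fun r : ℝ => r ^ m * Real.exp (-r ^ (2 : ℝ))) r),
    integral_volumeIoiPow _ (fun r : ℝ => r ^ m * Real.exp (-r ^ (2 : ℝ)))]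
  congr 1
  have hq : (m + Module.finrank ℝ E) / 2 = ((m + Module.finrank ℝ E - 1) + 1) / 2 := by ring
  have hn' : (1 : ℝ) ≤ Module.finrank ℝ E := by exact_mod_cast hn
  rw [hq, ← integral_rpow_mul_exp_neg_rpow two_pos (by linarith)]
  refine setIntegral_congr_fun measurableSet_Ioi fun r hr => ?_
  rw [← mul_assoc, ← Real.rpow_natCast, ← Real.rpow_add hr]
  congr 2
  push_cast [hn]
  ring

/-- In polar coordinates `z = r θ` the ball `‖z - e‖ < 1` is the region `0 < r < 2 ⟪θ, e⟫`, over which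
the radial integral is elementary. -/
theorem integral_ball_norm_rpow_mul_inner (hE : 2 ≤ Module.finrank ℝ E) {e : E} (he : ‖e‖ = 1)
    {σ : ℝ} (hσ : 1 - (Module.finrank ℝ E : ℝ) < σ) :
    ∫ z in ball e 1, ‖z‖ ^ (σ - 2) * inner ℝ z e ∂μ =
      2 ^ (Module.finrank ℝ E + σ - 1) / (Module.finrank ℝ E + σ - 1) *
        hemisphereMoment μ e (Module.finrank ℝ E + σ) := by
  have : Nontrivial E := Module.nontrivial_of_finrank_pos (R := ℝ) (by omega)
  set n := Module.finrank ℝ E with hn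
  have hn1 : 1 ≤ n := by omega
  have hint : Integrable ((ball e 1).indicator fun z => ‖z‖ ^ (σ - 2) * inner ℝ z e) μ := by
    rw [integrable_indicator_iff measurableSet_ball]
    have hloc : LocallyIntegrable (fun z : E => ‖z‖ ^ (σ - 1)) μ :=
      locallyIntegrable_norm_rpow μ (by omega) (by linarith)
    refine ((hloc.integrableOn_isCompact (isCompact_closedBall e 1)).mono_set
      ball_subset_closedBall).mono' ?_ (.of_forall fun z => ?_)
    · exact ((measurable_norm.pow_const _).mul (by fun_prop)).aestronglyMeasurable
    · rcases eq_or_ne z 0 with rfl | hz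
      · simp only [inner_zero_left, mul_zero, norm_zero]
        positivity
      · rw [norm_mul, Real.norm_of_nonneg (by positivity)]
        calc ‖z‖ ^ (σ - 2) * ‖inner ℝ z e‖ ≤ ‖z‖ ^ (σ - 2) * (‖z‖ * ‖e‖) := by
              gcongr; exact norm_inner_le_norm z e
          _ = ‖z‖ ^ (σ - 1) := by
              rw [he, mul_one, ← Real.rpow_add_one (norm_ne_zero_iff.2 hz)]
              congr 1; ring
  rw [← integral_indicator measurableSet_ball, integral_polar, integral_prod _
    (integrable_polar μ hint), hemisphereMoment, ← integral_const_mul]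
  refine integral_congr_ae (.of_forall fun ⟨θ, hθ⟩ => ?_)
  have hθ' : ‖θ‖ = 1 := by simpa using hθ
  set c : ℝ := inner ℝ θ e with hc
  have hmem : ∀ r : ℝ, 0 < r → (r • θ ∈ ball e 1 ↔ r < 2 * c) := by
    intro r hr
    rw [mem_ball, dist_eq_norm, ← sq_lt_one_iff₀ (norm_nonneg _), norm_sub_sq_real, norm_smul,
      hθ', he, real_inner_smul_left, mul_one, Real.norm_of_nonneg hr.le, ← hc]
    constructor
    · intro h
      nlinarith
    · intro h
      nlinarith
  have e1 : ∀ r : Ioi (0 : ℝ), (ball e 1).indicator (fun z => ‖z‖ ^ (σ - 2) * inner ℝ z e)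
      ((r : ℝ) • θ) = (Iio (2 * c)).indicator (fun r => r ^ (σ - 1) * c) (r : ℝ) := by
    rintro ⟨r, hr⟩
    have hr' : 0 < r := hr
    by_cases h : r < 2 * c
    · rw [Set.indicator_of_mem ((hmem r hr').2 h)]
      rw [Set.indicator_of_mem (mem_Iio.2 h), norm_smul, hθ', real_inner_smul_left, mul_one,
        Real.norm_of_nonneg hr'.le, ← hc, ← mul_assoc, ← Real.rpow_add_one hr'.ne']
      congr 2; ring
    · rw [Set.indicator_of_notMem (mt (hmem r hr').1 h)]
      rw [Set.indicator_of_notMem (by simpa using h)]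
  simp only [e1]
  rw [integral_volumeIoiPow _ ((Iio (2 * c)).indicator fun r => r ^ (σ - 1) * c), ← hn]
  have e2 : ∀ r : ℝ, r ^ (n - 1) * (Iio (2 * c)).indicator (fun r => r ^ (σ - 1) * c) r =
      (Iio (2 * c)).indicator (fun r => r ^ (n - 1) * (r ^ (σ - 1) * c)) r := fun r => by
    by_cases h : r ∈ Iio (2 * c)
    · rw [Set.indicator_of_mem h, Set.indicator_of_mem h]
    · rw [Set.indicator_of_notMem h, Set.indicator_of_notMem h, mul_zero]
  simp only [e2]
  rw [setIntegral_indicator measurableSet_Iio, Ioi_inter_Iio]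
  have hpos : 0 < (n : ℝ) + σ - 1 := by linarith
  rcases le_or_gt c 0 with hc0 | hc0
  · rw [Ioo_eq_empty (by linarith), max_eq_right hc0, Real.zero_rpow (by linarith)]
    simp
  · rw [max_eq_left hc0.le, ← integral_Ioc_eq_integral_Ioo,
      setIntegral_congr_fun (g := fun r => r ^ ((n : ℝ) + σ - 2) * c) measurableSet_Ioc
      fun r hr => ?_, integral_mul_const, ← intervalIntegral.integral_of_le (by linarith),
      integral_rpow (Or.inl (by linarith))]
    · have h1 : (n : ℝ) + σ - 2 + 1 = n + σ - 1 := by ring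
      have h2 : c ^ ((n : ℝ) + σ) = c ^ ((n : ℝ) + σ - 1) * c := by
        rw [← Real.rpow_add_one hc0.ne']; congr 1; ring
      rw [h1, h2, Real.zero_rpow hpos.ne', Real.mul_rpow two_pos.le hc0.le]
      ring
    · simp only
      rw [← mul_assoc, ← Real.rpow_natCast, ← Real.rpow_add hr.1]
      congr 2
      push_cast [hn1]
      ring

end Polar

section Coordinates

open Set

theorem integral_max_rpow_mul_exp_neg {m : ℝ} (hm : 0 < m) :
    ∫ t : ℝ, (max t 0) ^ m * Real.exp (-t ^ (2 : ℕ)) = 1 / 2 * Real.Gamma ((m + 1) / 2) := by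
  rw [← integral_rpow_mul_exp_neg_rpow two_pos (by linarith), ←
    setIntegral_eq_integral_of_forall_compl_eq_zero (s := Ioi 0)]
  · refine setIntegral_congr_fun measurableSet_Ioi fun t ht => ?_
    rw [max_eq_left ht.out.le, Real.rpow_two]
  · intro t ht
    rw [max_eq_right (by simpa using ht), Real.zero_rpow hm.ne', zero_mul]

/-- The Gaussian moment of `⟪z, e⟫₊` in Cartesian coordinates, for `e` a coordinate vector. -/
theorem integral_max_coord_rpow_mul_exp_neg {ι : Type*} [Fintype ι] [DecidableEq ι] (i : ι) {m : ℝ}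
    (hm : 0 < m) :
    ∫ z : EuclideanSpace ℝ ι, (max (z i) 0) ^ m * Real.exp (-‖z‖ ^ (2 : ℝ)) =
      1 / 2 * Real.Gamma ((m + 1) / 2) * √Real.pi ^ (Fintype.card ι - 1) := by
  let f : ι → ℝ → ℝ := fun j t =>
    if j = i then (max t 0) ^ m * Real.exp (-t ^ (2 : ℕ)) else Real.exp (-t ^ (2 : ℕ))
  have h1 : ∀ z : EuclideanSpace ℝ ι,
      (max (z i) 0) ^ m * Real.exp (-‖z‖ ^ (2 : ℝ)) = ∏ j, f j (z.ofLp j) := by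
    intro z
    rw [Real.rpow_two, EuclideanSpace.real_norm_sq_eq, ← Finset.sum_neg_distrib, Real.exp_sum,
      ← Finset.mul_prod_erase _ _ (Finset.mem_univ i),
      ← Finset.mul_prod_erase _ _ (Finset.mem_univ i), ← mul_assoc]
    congr 1
    · simp [f]
    · refine Finset.prod_congr rfl fun j hj => ?_
      simp [f, Finset.ne_of_mem_erase hj]
  simp only [h1]
  have h2 := (EuclideanSpace.volume_preserving_symm_measurableEquiv_toLp ι).integral_comp
    (MeasurableEquiv.measurableEmbedding _) (fun x : ι → ℝ => ∏ j, f j (x j))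
  refine h2.trans ?_
  rw [integral_fintype_prod_volume_eq_prod f, ← Finset.mul_prod_erase _ _ (Finset.mem_univ i)]
  congr 1
  · simp only [f, if_true]
    exact integral_max_rpow_mul_exp_neg hm
  · rw [Finset.prod_congr rfl (g := fun _ => √Real.pi), Finset.prod_const,
      Finset.card_erase_of_mem (Finset.mem_univ i), Finset.card_univ]
    intro j hj
    simp only [f, if_neg (Finset.ne_of_mem_erase hj)]
    simpa using integral_gaussian 1

theorem hemisphereMoment_single {ι : Type*} [Fintype ι] [DecidableEq ι] (i : ι) {m : ℝ}
    (hm : 0 < m) :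
    hemisphereMoment (volume : Measure (EuclideanSpace ℝ ι)) (EuclideanSpace.single i 1) m =
      √Real.pi ^ (Fintype.card ι - 1) * Real.Gamma ((m + 1) / 2) /
        Real.Gamma ((m + Fintype.card ι) / 2) := by
  have : Nonempty ι := ⟨i⟩
  have h := integral_gaussian_eq_hemisphereMoment (volume : Measure (EuclideanSpace ℝ ι))
    (EuclideanSpace.single i 1) hm
  have hG : 0 < Real.Gamma ((m + Fintype.card ι) / 2) := Real.Gamma_pos_of_pos (by positivity)
  have hi : ∀ z : EuclideanSpace ℝ ι, inner ℝ z (EuclideanSpace.single i 1) = z i := fun z => by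
    simp [EuclideanSpace.inner_single_right]
  simp only [hi, integral_max_coord_rpow_mul_exp_neg i hm, finrank_euclideanSpace] at h
  rw [eq_div_iff hG.ne']
  linarith

end Coordinates

/-! ### A product tending to zero -/

section Product

open Filter Topology

/-- By Euler's limit formula the product is asymptotic to a multiple of `k ^ (a - b)`, unless `a` is a
nonpositive integer, in which case a factor vanishes. -/
theorem tendsto_prod_div_atTop_zero {a b : ℝ} (hb : 0 < b) (hab : a < b) :
    Tendsto (fun k : ℕ => ∏ j ∈ Finset.range k, (a + j) / (b + j)) atTop (𝓝 0) := by
  by_cases ha : ∃ m : ℕ, a = -m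
  · obtain ⟨m, hm⟩ := ha
    refine tendsto_const_nhds.congr' ?_
    filter_upwards [eventually_gt_atTop m] with k hk
    refine (Finset.prod_eq_zero (Finset.mem_range.2 hk) ?_).symm
    rw [hm, neg_add_cancel, zero_div]
  · push Not at ha
    rw [← tendsto_add_atTop_iff_nat 1]
    have hbp : ∀ n : ℕ, ∏ j ∈ Finset.range (n + 1), (b + j) ≠ 0 := fun n =>
      Finset.prod_ne_zero_iff.2 fun j _ => by positivity
    have hap : ∀ n : ℕ, ∏ j ∈ Finset.range (n + 1), (a + j) ≠ 0 := fun n =>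
      Finset.prod_ne_zero_iff.2 fun j _ h => ha j (by linarith)
    have h1 : Tendsto (fun n : ℕ => (n : ℝ) ^ (-(b - a)) *
        (Real.GammaSeq b n / Real.GammaSeq a n)) atTop (𝓝 0) := by
      have := ((tendsto_rpow_neg_atTop (sub_pos.2 hab)).comp tendsto_natCast_atTop_atTop).mul
        ((Real.GammaSeq_tendsto_Gamma b).div (Real.GammaSeq_tendsto_Gamma a)
          (Real.Gamma_ne_zero ha))
      simpa using this
    refine h1.congr' ?_
    filter_upwards [eventually_gt_atTop 0] with n hn
    have hn' : (0 : ℝ) < n := by exact_mod_cast hn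
    have hf : (n.factorial : ℝ) ≠ 0 := by positivity
    have hb' : (n : ℝ) ^ b ≠ 0 := (Real.rpow_pos_of_pos hn' b).ne'
    have ha' : (n : ℝ) ^ a ≠ 0 := (Real.rpow_pos_of_pos hn' a).ne'
    rw [Finset.prod_div_distrib, Real.GammaSeq, Real.GammaSeq, neg_sub, Real.rpow_sub hn']
    have := hap n
    have := hbp n
    field_simp

end Product

/-! ### The potential of the unit ball -/

section BallPotential

open Filter Topology Metric

/-- The common closed form of two quantities: the radial derivative at the unit sphere of
`x ↦ ∫ y in B₁, ‖x - y‖ ^ σ`, and half the limit of `μ₁(σ) - μₖ(σ)` as `k → ∞`. -/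
noncomputable def ballSlope (d : ℕ) (σ : ℝ) : ℝ :=
  σ * (2 ^ ((d : ℝ) + σ - 1) / 2 * √Real.pi ^ (d - 1) * Real.Gamma (((d : ℝ) + σ - 1) / 2) /
    Real.Gamma ((d : ℝ) + σ / 2))

theorem ballSlope_pos {d : ℕ} (hd : 2 ≤ d) {σ : ℝ} (hσ : 0 < σ) : 0 < ballSlope d σ := by
  have hd' : (2 : ℝ) ≤ d := by exact_mod_cast hd
  have h1 : 0 < Real.Gamma (((d : ℝ) + σ - 1) / 2) := Real.Gamma_pos_of_pos (by linarith)
  have h2 : 0 < Real.Gamma ((d : ℝ) + σ / 2) := Real.Gamma_pos_of_pos (by linarith)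
  have := Real.pi_pos
  rw [ballSlope]
  positivity

theorem natCast_mul_unitBallVolume_mul_Gamma {n : ℕ} (hn : n ≠ 0) :
    (n : ℝ) * unitBallVolume n * Real.Gamma (n / 2) = 2 * √Real.pi ^ n := by
  have : Nonempty (Fin n) := ⟨⟨0, Nat.pos_of_ne_zero hn⟩⟩
  have hn' : (0 : ℝ) < n := by exact_mod_cast Nat.pos_of_ne_zero hn
  have hG : 0 < Real.Gamma ((n : ℝ) / 2) := Real.Gamma_pos_of_pos (by positivity)
  rw [unitBallVolume, EuclideanSpace.volume_ball, Fintype.card_fin, ENNReal.ofReal_one, one_pow,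
    one_mul, ENNReal.toReal_ofReal (by rw [Real.Gamma_add_one (by positivity)]; positivity),
    Real.Gamma_add_one (by positivity)]
  field_simp

/-- Write `μₖ(σ) = C (1 - Πₖ)`. As `Πₖ → 0`, the difference `μ₁(σ) - μₖ(σ)` tends to `-C Π₁`, and
`Π₁ = (-σ / 2) / (d - 1 + σ / 2)`. -/
theorem tendsto_muCoeff_one_sub {d : ℕ} (hd : 2 ≤ d) {σ : ℝ} (hσ : 1 - (d : ℝ) < σ) :
    Tendsto (fun k => muCoeff d σ 1 - muCoeff d σ k) atTop (𝓝 (2 * ballSlope d σ)) := by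
  have hd' : (2 : ℝ) ≤ d := by exact_mod_cast hd
  set C : ℝ := ((d : ℝ) - 1) * unitBallVolume (d - 1) * (2 : ℝ) ^ ((d : ℝ) - 1 + σ) *
    (Real.Gamma (((d : ℝ) - 1 + σ) / 2) * Real.Gamma (((d : ℝ) - 1) / 2) /
      Real.Gamma ((2 * (d : ℝ) - 2 + σ) / 2)) with hC
  have hb : 0 < (d : ℝ) - 1 + σ / 2 := by linarith
  have hP : Tendsto (fun k : ℕ => ∏ j ∈ Finset.range k,
      ((j : ℝ) - σ / 2) / ((j : ℝ) + (d : ℝ) - 1 + σ / 2)) atTop (𝓝 0) := by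
    refine (tendsto_prod_div_atTop_zero (a := -(σ / 2)) hb (by linarith)).congr fun k => ?_
    refine Finset.prod_congr rfl fun j _ => ?_
    congr 1 <;> ring
  have hlim := (hP.sub_const ((-(σ / 2)) / ((d : ℝ) - 1 + σ / 2))).const_mul C
  have hval : C * (0 - (-(σ / 2)) / ((d : ℝ) - 1 + σ / 2)) = 2 * ballSlope d σ := by
    have hω := natCast_mul_unitBallVolume_mul_Gamma (n := d - 1) (by omega)
    rw [Nat.cast_sub (by omega : 1 ≤ d), Nat.cast_one] at hω
    have hG : Real.Gamma ((d : ℝ) + σ / 2) =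
        ((d : ℝ) - 1 + σ / 2) * Real.Gamma ((2 * (d : ℝ) - 2 + σ) / 2) := by
      rw [show (2 * (d : ℝ) - 2 + σ) / 2 = (d : ℝ) - 1 + σ / 2 by ring,
        ← Real.Gamma_add_one hb.ne']
      congr 1; ring
    have hG0 : Real.Gamma ((2 * (d : ℝ) - 2 + σ) / 2) ≠ 0 :=
      (Real.Gamma_pos_of_pos (by linarith)).ne'
    have hC' : C = (((d : ℝ) - 1) * unitBallVolume (d - 1) * Real.Gamma (((d : ℝ) - 1) / 2)) *
        (2 : ℝ) ^ ((d : ℝ) - 1 + σ) * Real.Gamma (((d : ℝ) - 1 + σ) / 2) /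
        Real.Gamma ((2 * (d : ℝ) - 2 + σ) / 2) := by rw [hC]; ring
    rw [hC', hω, ballSlope, hG, show (d : ℝ) + σ - 1 = d - 1 + σ by ring]
    have hb0 := hb.ne'
    generalize (d : ℝ) - 1 + σ / 2 = b at hb0 ⊢
    generalize Real.Gamma ((2 * (d : ℝ) - 2 + σ) / 2) = G at hG0 ⊢
    field_simp
    ring
  rw [hval] at hlim
  refine hlim.congr fun k => ?_
  simp only [muCoeff, ← hC, Finset.prod_range_one, Nat.cast_zero, zero_sub, zero_add]
  ring

variable {d : ℕ}

/-- The potential of a ball is radial: a reflection carries `x` to any `x'` of the same norm. -/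
theorem setIntegral_ball_norm_sub_eq_of_norm_eq {E : Type*} [NormedAddCommGroup E]
    [InnerProductSpace ℝ E] [FiniteDimensional ℝ E] [MeasurableSpace E] [BorelSpace E]
    (g : ℝ → ℝ) (r : ℝ) {x x' : E} (h : ‖x‖ = ‖x'‖) :
    ∫ y in ball (0 : E) r, g ‖x - y‖ = ∫ y in ball (0 : E) r, g ‖x' - y‖ := by
  set R := (ℝ ∙ (x - x'))ᗮ.reflection with hR
  have hx : R x = x' := Submodule.reflection_sub h
  have h1 := R.measurePreserving.setIntegral_preimage_emb
    R.toHomeomorph.measurableEmbedding (fun y => g ‖x' - y‖) (ball 0 r)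
  rw [← h1, R.preimage_ball, map_zero]
  refine setIntegral_congr_fun measurableSet_ball fun y _ => ?_
  change g ‖x - y‖ = g ‖x' - R y‖
  rw [← hx, ← map_sub, R.norm_map]

theorem ballPotential_eq (d : ℕ) (α β γ : ℝ) :
    ballPotential d α β γ = fun x =>
      (∫ y in ball (0 : EuclideanSpace ℝ (Fin d)) 1, ‖x - y‖ ^ (-α)) +
        γ * ∫ y in ball (0 : EuclideanSpace ℝ (Fin d)) 1, ‖x - y‖ ^ β := by
  ext x
  simp only [ballPotential, Real.rpow_neg (norm_nonneg _), one_div]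

theorem contDiff_one_setIntegral_ball_norm_rpow (hd : 2 ≤ d) {σ : ℝ} (hσ : 1 - (d : ℝ) < σ) :
    ContDiff ℝ 1 fun x : EuclideanSpace ℝ (Fin d) => ∫ y in ball 0 1, ‖x - y‖ ^ σ := by
  have hE : Module.finrank ℝ (EuclideanSpace ℝ (Fin d)) = d := by simp
  exact contDiff_one_setIntegral_ball_sub_left (k := fun z => ‖z‖ ^ σ) (by rw [hE]; exact hd)
    (locallyIntegrable_norm_rpow _ (by omega) (by rw [hE]; linarith))
    (locallyIntegrable_normRpowDeriv _ (by omega) (by rwa [hE]))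
    (continuousOn_normRpowDeriv σ) (fun z hz => hasFDerivAt_norm_rpow_of_ne σ hz) 1

/-- The slope at the unit sphere of the profile of the potential with kernel `‖z‖ ^ σ`. -/
theorem hasDerivAt_setIntegral_ball_norm_rpow (hd : 2 ≤ d) {σ : ℝ} (hσ : 1 - (d : ℝ) < σ)
    (i : Fin d) :
    HasDerivAt (fun t : ℝ => ∫ y in ball (0 : EuclideanSpace ℝ (Fin d)) 1,
      ‖t • EuclideanSpace.single i (1 : ℝ) - y‖ ^ σ) (ballSlope d σ) 1 := by
  have hd' : (2 : ℝ) ≤ d := by exact_mod_cast hd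
  set e : EuclideanSpace ℝ (Fin d) := EuclideanSpace.single i 1 with he
  have hE : Module.finrank ℝ (EuclideanSpace ℝ (Fin d)) = d := by simp
  have hl' : LocallyIntegrable (normRpowDeriv σ : EuclideanSpace ℝ (Fin d) → _) volume :=
    locallyIntegrable_normRpowDeriv _ (by omega) (by rwa [hE])
  have h1 := hasFDerivAt_setIntegral_ball_sub_left (k := fun z => ‖z‖ ^ σ) (by rw [hE]; exact hd)
    (locallyIntegrable_norm_rpow volume (by omega) (by rw [hE]; linarith)) hl'
    (continuousOn_normRpowDeriv σ) (fun z hz => hasFDerivAt_norm_rpow_of_ne σ hz) 1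
    ((1 : ℝ) • e)
  have h2 := h1.comp_hasDerivAt (1 : ℝ) ((hasDerivAt_id (1 : ℝ)).smul_const e)
  have hval : (∫ y in ball 0 1, normRpowDeriv σ ((1 : ℝ) • e - y)) ((1 : ℝ) • e) =
      ballSlope d σ := by
    rw [one_smul, ContinuousLinearMap.integral_apply (hl'.integrableOn_ball_sub_left e 1) e,
      setIntegral_ball_sub_left volume (fun z => normRpowDeriv σ z e) e 1]
    have h3 : ∀ z, normRpowDeriv σ z e = σ * (‖z‖ ^ (σ - 2) * inner ℝ z e) := fun z => by
      simp [normRpowDeriv, mul_assoc]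
    simp only [h3]
    rw [integral_const_mul, integral_ball_norm_rpow_mul_inner volume (by omega) (by simp [he])
      (by rwa [hE]), hE, he, hemisphereMoment_single i (by linarith), Fintype.card_fin, ballSlope,
      show ((d : ℝ) + σ + 1) / 2 = (d + σ - 1) / 2 + 1 by ring,
      Real.Gamma_add_one (by linarith), show ((d : ℝ) + σ + d) / 2 = d + σ / 2 by ring]
    have : (d : ℝ) + σ - 1 ≠ 0 := by linarith
    field_simp
  rw [← hval]
  exact h2

end BallPotential

theorem mainTheorem5 (d : ℕ) (hd : 2 ≤ d) (α β γ : ℝ)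
    (hα : 0 < α) (hαd : α < (d : ℝ) - 1) (hβ : 0 < β) (hγ : 0 < γ) :
    (∀ x : EuclideanSpace ℝ (Fin d),
      IntegrableOn (fun y => 1 / ‖x - y‖ ^ α) (Metric.ball (0 : EuclideanSpace ℝ (Fin d)) 1) ∧
      IntegrableOn (fun y => ‖x - y‖ ^ β) (Metric.ball (0 : EuclideanSpace ℝ (Fin d)) 1)) ∧
    ContDiff ℝ 1 (ballPotential d α β γ) ∧
    ∃ p : ℝ → ℝ,
      (∀ x : EuclideanSpace ℝ (Fin d), ballPotential d α β γ x = p ‖x‖) ∧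
      ContDiffOn ℝ 1 p (Set.Ici 0) ∧
      (gammaStar d α β < (γ : EReal) → 0 < deriv p 1) ∧
      ((γ : EReal) < gammaStarStar d α β → deriv p 1 < 0) := by
  have hd' : (2 : ℝ) ≤ d := by exact_mod_cast hd
  have hE : Module.finrank ℝ (EuclideanSpace ℝ (Fin d)) = d := by simp
  have hα' : 1 - (d : ℝ) < -α := by linarith
  have hβ' : 1 - (d : ℝ) < β := by linarith
  have hC1 : ContDiff ℝ 1 (ballPotential d α β γ) := by
    rw [ballPotential_eq]
    exact (contDiff_one_setIntegral_ball_norm_rpow hd hα').add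
      (contDiff_const.mul (contDiff_one_setIntegral_ball_norm_rpow hd hβ'))
  have hloc : ∀ σ : ℝ, 1 - (d : ℝ) < σ →
      LocallyIntegrable (fun z : EuclideanSpace ℝ (Fin d) => ‖z‖ ^ σ) volume := fun σ hσ =>
    locallyIntegrable_norm_rpow volume (by omega) (by rw [hE]; linarith)
  refine ⟨fun x => ⟨?_, (hloc β hβ').integrableOn_ball_sub_left x 1⟩, hC1, ?_⟩
  · simpa only [Real.rpow_neg (norm_nonneg _), one_div]
      using (hloc (-α) hα').integrableOn_ball_sub_left x 1
  let i : Fin d := ⟨0, by omega⟩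
  set e : EuclideanSpace ℝ (Fin d) := EuclideanSpace.single i 1 with he
  have hnorm : ∀ x : EuclideanSpace ℝ (Fin d), ‖x‖ = ‖‖x‖ • e‖ := fun x => by
    simp [he, norm_smul]
  have hp : HasDerivAt (fun t : ℝ => ballPotential d α β γ (t • e))
      (ballSlope d (-α) + γ * ballSlope d β) 1 := by
    rw [ballPotential_eq]
    exact (hasDerivAt_setIntegral_ball_norm_rpow hd hα' i).add
      ((hasDerivAt_setIntegral_ball_norm_rpow hd hβ' i).const_mul γ)
  have hpos : 0 < ballSlope d β := ballSlope_pos hd hβ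
  have hlim : Filter.Tendsto (fun k => (stabilityQuotient d α β k : EReal)) Filter.atTop
      (nhds ((-ballSlope d (-α) / ballSlope d β : ℝ) : EReal)) := by
    refine (continuous_coe_real_ereal.tendsto _).comp ?_
    have h := (tendsto_muCoeff_one_sub hd hα').neg.div (tendsto_muCoeff_one_sub hd hβ')
      (by positivity)
    rw [← mul_neg, mul_div_mul_left _ _ two_ne_zero] at h
    refine h.congr fun k => ?_
    simp [stabilityQuotient]
  refine ⟨fun t => ballPotential d α β γ (t • e), fun x => ?_, ?_, fun h => ?_, fun h => ?_⟩
  · rw [ballPotential_eq]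
    refine congrArg₂ (· + ·) ?_ (congrArg (γ * ·) ?_)
    · exact setIntegral_ball_norm_sub_eq_of_norm_eq (fun s => s ^ (-α)) 1 (hnorm x)
    · exact setIntegral_ball_norm_sub_eq_of_norm_eq (fun s => s ^ β) 1 (hnorm x)
  · exact (hC1.comp (contDiff_id.smul contDiff_const)).contDiffOn
  · rw [hp.deriv]
    have hle : ((-ballSlope d (-α) / ballSlope d β : ℝ) : EReal) ≤ gammaStar d α β :=
      le_of_tendsto hlim (Filter.eventually_atTop.2 ⟨2, fun k hk =>
        le_iSup₂ (f := fun (k : ℕ) (_ : 2 ≤ k) => (stabilityQuotient d α β k : EReal)) k hk⟩)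
    have := EReal.coe_lt_coe_iff.1 (hle.trans_lt h)
    rw [div_lt_iff₀ hpos] at this
    linarith
  · rw [hp.deriv]
    have hle : gammaStarStar d α β ≤ ((-ballSlope d (-α) / ballSlope d β : ℝ) : EReal) :=
      ge_of_tendsto hlim (Filter.eventually_atTop.2 ⟨2, fun k hk =>
        iInf₂_le (f := fun (k : ℕ) (_ : 2 ≤ k) => (stabilityQuotient d α β k : EReal)) k hk⟩)
    have := EReal.coe_lt_coe_iff.1 (h.trans_le hle)
    rw [lt_div_iff₀ hpos] at this
    linarith
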